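/- A 3SAT instance $I$ consists of a finite set of Boolean variables and a finite multiset of $m$ clauses, each a disjunction of three literals on three distinct variables. It is $c$-satisfiable if some truth assignment satisfies at least $cm$ of the clauses, counted with multiplicity, and satisfiable if some assignment satisfies all of them. Instances are viewed as finite relational structures in either of two ways. In the first encoding the universe is the disjoint union of the variables and the clauses, with binary relations $E_1,E_2,E_3$, where $E_i(x,c)$ says that $x$ is the $i$th variable of the clause $c$, and a unary relation for each of the eight sign patterns, holding of the clauses of that pattern. In the second encoding, used for instances without repeated clauses (a clause being given by its sign pattern and its ordered triple of variables), the universe is the set of variables, with a ternary relation for each of the eight sign patterns, holding of the triples $(x,y,z)$ such that the clause of that pattern on $x,y,z$ (in this order) occurs in $I$. For a positive integer $k$, let $C^k$ be the fragment of first-order logic with counting quantifiers $\exists^i x$ ("there are at least $i$ elements $x$") in which at most $k$ distinct variables appear, free or bound, and write $\mathbb{A}\equiv^k\mathbb{B}$ if no sentence of $C^k$ distinguishes $\mathbb{A}$ from $\mathbb{B}$. For $k:\mathbb{N}\to\mathbb{N}$, classes $\mathcal{C},\mathcal{D}$ of finite structures are $C^k$-separable if $\mathbb{A}\not\equiv^{k(n)}\mathbb{B}$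 for all $n$ and all $\mathbb{A}\in\mathcal{C}$, $\mathbb{B}\in\mathcal{D}$ with at most $n$ elements. Theorem. Let $\varepsilon>0$ be real. In each of the two encodings, let $\mathcal{C}$ be the class of structures isomorphic to the encoding of a satisfiable 3SAT instance, and let $\mathcal{D}$ be the class of structures isomorphic to the encoding of a 3SAT instance that is not $(7/8+\varepsilon)$-satisfiable. Then $\mathcal{C}$ and $\mathcal{D}$ are not $C^k$-separable for any $k:\mathbb{N}\to\mathbb{N}$ with $k(n)=o(n)$. -/

import Mathlib

open scoped FirstOrder
open Filter Asymptotics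

namespace CountingLogic

/-- Formulas of the `k`-variable fragment `C^k` of first-order logic with counting quantifiers,
over a relational vocabulary `L`. The only variables that may appear, free or bound, are the
`k` variables indexed by `Fin k`; a variable may be requantified any number of times.
`atLeast i x φ` is the counting quantifier `∃^i x φ`. -/
inductive CFormula (L : FirstOrder.Language.{0, 0}) (k : ℕ) : Type
  | falsum : CFormula L k
  | eq (x y : Fin k) : CFormula L k
  | rel {l : ℕ} (R : L.Relations l) (xs : Fin l → Fin k) : CFormula L k
  | not (φ : CFormula L k) : CFormula L k
  | and (φ ψ : CFormula L k) : CFormula L k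
  | or (φ ψ : CFormula L k) : CFormula L k
  | all (x : Fin k) (φ : CFormula L k) : CFormula L k
  | atLeast (i : ℕ) (x : Fin k) (φ : CFormula L k) : CFormula L k

namespace CFormula

variable {L : FirstOrder.Language.{0, 0}} {k : ℕ}

/-- The free variables of a formula. -/
def freeVars : CFormula L k → Finset (Fin k)
  | falsum => ∅
  | eq x y => {x, y}
  | rel _ xs => Finset.univ.image xs
  | not φ => φ.freeVars
  | and φ ψ => φ.freeVars ∪ ψ.freeVars
  | or φ ψ => φ.freeVars ∪ ψ.freeVars
  | all x φ => φ.freeVars.erase x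
  | atLeast _ x φ => φ.freeVars.erase x

/-- Satisfaction of a formula in a structure under an assignment to the `k` variables. -/
def Realize {A : Type} [L.Structure A] : CFormula L k → (Fin k → A) → Prop
  | falsum, _ => False
  | eq x y, v => v x = v y
  | rel R xs, v => FirstOrder.Language.Structure.RelMap R (fun i => v (xs i))
  | not φ, v => ¬ φ.Realize v
  | and φ ψ, v => φ.Realize v ∧ ψ.Realize v
  | or φ ψ, v => φ.Realize v ∨ ψ.Realize v
  | all x φ, v => ∀ a : A, φ.Realize (Function.update v x a)
  | atLeast i x φ, v =>
      ∃ S : Finset A, S.card = i ∧ ∀ a ∈ S, φ.Realize (Function.update v x a)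

end CFormula

/-- A finite structure over the vocabulary `L`; as usual the universe is nonempty. -/
structure FinStr (L : FirstOrder.Language.{0, 0}) : Type 1 where
  carrier : Type
  [str : L.Structure carrier]
  [fin : Finite carrier]
  [ne : Nonempty carrier]

attribute [instance] FinStr.str FinStr.fin FinStr.ne

/-- Truth of a `C^k`-sentence in a finite structure. (For a sentence, the assignment of the
variables is irrelevant.) -/
def FinStr.Models {L : FirstOrder.Language.{0, 0}} {k : ℕ} (A : FinStr L) (φ : CFormula L k) : Prop :=
  ∀ v : Fin k → A.carrier, φ.Realize v

/-- `A ≡^k B`: no sentence of `C^k` distinguishes `A` from `B`. -/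
def CkEquiv {L : FirstOrder.Language.{0, 0}} [L.IsRelational] (k : ℕ) (A B : FinStr L) : Prop :=
  ∀ φ : CFormula L k, φ.freeVars = ∅ → (A.Models φ ↔ B.Models φ)

/-- Two classes `C`, `D` of finite structures are `C^k`-separable, for `k : ℕ → ℕ`, if
`A ≢^{k(n)} B` whenever `A ∈ C` and `B ∈ D` have at most `n` elements. -/
def CkSeparable {L : FirstOrder.Language.{0, 0}} [L.IsRelational] (C D : Set (FinStr L)) (k : ℕ → ℕ) :
    Prop :=
  ∀ n : ℕ, ∀ A ∈ C, ∀ B ∈ D, Nat.card A.carrier ≤ n → Nat.card B.carrier ≤ n →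
    ¬ CkEquiv (k n) A B

end CountingLogic

namespace ThreeSAT

open CountingLogic

/-- A 3SAT instance: a finite set `Var` of Boolean variables and a finite multiset of clauses,
given as a family indexed by `Con`. The clause `j` is the disjunction of three literals on the
distinct variables `vars j 0, vars j 1, vars j 2`, the literal on `vars j i` being positive if
`sign j i = true` and negative otherwise. The eight possible values of `sign j` are the eight
relations of the constraint language of 3SAT. -/
structure Instance : Type 1 where
  Var : Type
  Con : Type
  [finVar : Finite Var]
  [finCon : Finite Con]
  sign : Con → Fin 3 → Bool
  vars : Con → Fin 3 ↪ Var

namespace Instance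

/-- The assignment `f` satisfies the clause `j`. -/
def Holds (I : Instance) (f : I.Var → Bool) (j : I.Con) : Prop :=
  ∃ i : Fin 3, f (I.vars j i) = I.sign j i

/-- Some assignment satisfies all the clauses. -/
def Satisfiable (I : Instance) : Prop :=
  ∃ f : I.Var → Bool, ∀ j, I.Holds f j

/-- Some assignment satisfies at least `c * m` of the `m` clauses, counted with multiplicity. -/
def CSatisfiable (I : Instance) (c : ℝ) : Prop :=
  ∃ f : I.Var → Bool, c * (Nat.card I.Con : ℝ) ≤ (Nat.card {j : I.Con // I.Holds f j} : ℝ)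

/-- No clause is repeated: the multiset of clauses is a set. -/
def IsSimple (I : Instance) : Prop :=
  Function.Injective fun j : I.Con => (I.sign j, I.vars j)

end Instance

/-- Relation symbols of the first encoding: binary `E 0, E 1, E 2` and, for each of the eight
clause types `s`, a unary `Z s`. -/
inductive Rel₁ : ℕ → Type
  | E (i : Fin 3) : Rel₁ 2
  | Z (s : Fin 3 → Bool) : Rel₁ 1

/-- The vocabulary of the first encoding. -/
def L₁ : FirstOrder.Language.{0, 0} := ⟨fun _ => Empty, Rel₁⟩

instance : L₁.IsRelational := fun _ => inferInstanceAs (IsEmpty Empty)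

/-- The universe of the first encoding: the disjoint union of the variables and the clauses. -/
def Enc₁ (I : Instance) : Type := I.Var ⊕ I.Con

/-- First encoding: `E i (x, c)` says that `x` is the `i`-th variable of the clause `c`, and
`Z s (c)` says that `c` is a clause of type `s`. -/
instance (I : Instance) : L₁.Structure (Enc₁ I) where
  funMap := fun F => Empty.elim F
  RelMap := fun R => match R with
    | Rel₁.E i => fun a => ∃ j : I.Con, a 0 = Sum.inl (I.vars j i) ∧ a 1 = Sum.inr j
    | Rel₁.Z s => fun a => ∃ j : I.Con, a 0 = Sum.inr j ∧ I.sign j = s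

/-- Relation symbols of the second encoding: one ternary symbol for each of the eight clause
types. -/
inductive Rel₂ : ℕ → Type
  | R (s : Fin 3 → Bool) : Rel₂ 3

/-- The vocabulary of the second encoding. -/
def L₂ : FirstOrder.Language.{0, 0} := ⟨fun _ => Empty, Rel₂⟩

instance : L₂.IsRelational := fun _ => inferInstanceAs (IsEmpty Empty)

/-- The universe of the second encoding: the variables. -/
def Enc₂ (I : Instance) : Type := I.Var

/-- Second encoding: `R s (x₀, x₁, x₂)` says that the clause of type `s` on the variables
`x₀, x₁, x₂`, in this order, is one of the clauses of the instance. -/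
instance (I : Instance) : L₂.Structure (Enc₂ I) where
  funMap := fun F => Empty.elim F
  RelMap := fun R => match R with
    | Rel₂.R s => fun a => ∃ j : I.Con, I.sign j = s ∧ ∀ i : Fin 3, I.vars j i = a i

/-- The class of the finite structures that are, up to isomorphism, the first encoding of a 3SAT
instance with the property `P`. -/
def class₁ (P : Instance → Prop) : Set (FinStr L₁) :=
  {A | ∃ I : Instance, P I ∧ Nonempty (A.carrier ≃[L₁] Enc₁ I)}

/-- The class of the finite structures that are, up to isomorphism, the second encoding of a 3SAT
instance with the property `P`. This encoding forgets multiplicities, so the instance is one whose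
clauses form a set. -/
def class₂ (P : Instance → Prop) : Set (FinStr L₂) :=
  {A | ∃ I : Instance, I.IsSimple ∧ P I ∧ Nonempty (A.carrier ≃[L₂] Enc₂ I)}

end ThreeSAT

/-! Take `c * N` equations over F₂, each on three vertices, one from each of three blocks of size
`N`, with right-hand side `b`. Every vertex gets two copies, standing for `x` and `x + 1`, and each
equation between copies becomes four clauses: all four hold if the equation does, and exactly three
otherwise. For `b = 0` the instance is satisfiable. For random `b` and large constant `c`, a
Chernoff bound and a union bound over the `2 ^ (6 * N)` assignments give a `b` for which every
assignment satisfies less than a fraction `7/8 + ε` of the clauses (`exists_not_cSatisfiable`).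

Swapping the two copies of the vertices where `f` is one carries the clauses for `b` to those for
`b'` at every equation where `f` solves the system with right-hand side `b + b'` (`sign_shiftCon`).
A global solution would be an isomorphism; Duplicator needs only an `f` that is not refuted by few
equations on the vertices under the pebbles. If the system expands, such an `f` extends to further
vertices as long as few are pebbled (`LocallyConsistent.exists_insert`), which yields a winning
strategy in the bijective game (`ckEquiv_of_shift`). A random system expands up to a linear number
of equations (`exists_expands`), so every `k = o(n)` is eventually small enough. -/

open scoped Matrix

/-! ### The bijective pebble game -/

namespace CountingLogic

/-- If Spoiler cannot win the `k`-pebble bijective game from a position, then the position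
satisfies the same `C^k`-formulas on both sides. The relation `P` is a winning strategy. -/
theorem CFormula.realize_iff_of_bijective_game {L : FirstOrder.Language.{0, 0}} {k : ℕ}
    {A B : Type} [L.Structure A] [L.Structure B] (P : (Fin k → A) → (Fin k → B) → Prop)
    (heq : ∀ v w, P v w → ∀ x y, v x = v y ↔ w x = w y)
    (hrel : ∀ v w, P v w → ∀ (l : ℕ) (R : L.Relations l) (xs : Fin l → Fin k),
      FirstOrder.Language.Structure.RelMap R (fun i => v (xs i)) ↔
        FirstOrder.Language.Structure.RelMap R (fun i => w (xs i)))
    (hext : ∀ v w, P v w → ∀ x, ∃ π : A ≃ B,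
      ∀ a, P (Function.update v x a) (Function.update w x (π a)))
    (φ : CFormula L k) : ∀ v w, P v w → (φ.Realize v ↔ φ.Realize w) := by
  induction φ with
  | falsum => exact fun _ _ _ => Iff.rfl
  | eq x y => exact fun v w h => heq v w h x y
  | rel R xs => exact fun v w h => hrel v w h _ R xs
  | not φ ih => exact fun v w h => not_congr (ih v w h)
  | and φ ψ ih₁ ih₂ => exact fun v w h => and_congr (ih₁ v w h) (ih₂ v w h)
  | or φ ψ ih₁ ih₂ => exact fun v w h => or_congr (ih₁ v w h) (ih₂ v w h)
  | all x φ ih =>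
    intro v w h
    obtain ⟨π, hπ⟩ := hext v w h x
    exact π.forall_congr fun a => ih _ _ (hπ a)
  | atLeast i x φ ih =>
    intro v w h
    obtain ⟨π, hπ⟩ := hext v w h x
    constructor
    · rintro ⟨S, hS, hφ⟩
      refine ⟨S.map π.toEmbedding, by simpa using hS, fun b hb => ?_⟩
      obtain ⟨a, ha, rfl⟩ := Finset.mem_map.1 hb
      exact (ih _ _ (hπ a)).1 (hφ a ha)
    · rintro ⟨S, hS, hφ⟩
      refine ⟨S.map π.symm.toEmbedding, by simpa using hS, fun a ha => ?_⟩
      obtain ⟨b, hb, rfl⟩ := Finset.mem_map.1 ha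
      refine (ih _ _ (hπ _)).2 ?_
      simpa using hφ b hb

end CountingLogic

/-! ### Local solutions of expanding parity systems -/

namespace ParitySystem

variable {E U : Type} [Fintype E] [Fintype U]

/-- Sums of at most `R` rows of `A` have support of size at least half the number of rows. -/
def Expands (A : Matrix E U Bool) (R : ℕ) : Prop :=
  ∀ y : E → Bool, hammingNorm y ≤ R → hammingNorm y ≤ 2 * hammingNorm (y ᵥ* A)

/-- No combination of at most `r` equations of the system `A f = d` refutes `f` restricted
to `X`. -/
def LocallyConsistent (A : Matrix E U Bool) (d : E → Bool) (r : ℕ) (f : U → Bool)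
    (X : Finset U) : Prop :=
  ∀ y : E → Bool, hammingNorm y ≤ r → (∀ u ∉ X, (y ᵥ* A) u = 0) → (y ᵥ* A) ⬝ᵥ f = y ⬝ᵥ d

variable {A : Matrix E U Bool} {d : E → Bool} {r : ℕ} {f : U → Bool} {X Y T : Finset U}

theorem LocallyConsistent.mono (h : LocallyConsistent A d r f Y) (hXY : X ⊆ Y) :
    LocallyConsistent A d r f X :=
  fun y hy hX => h y hy fun u hu => hX u fun hu' => hu (hXY hu')

theorem hammingNorm_le_card {y : U → Bool} (h : ∀ u ∉ X, y u = 0) : hammingNorm y ≤ X.card := by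
  refine Finset.card_le_card fun u hu => ?_
  by_contra hu'
  exact (Finset.mem_filter.1 hu).2 (h u hu')

theorem hammingNorm_add_le (y z : U → Bool) :
    hammingNorm (y + z) ≤ hammingNorm y + hammingNorm z := by
  classical
  refine (Finset.card_le_card fun u hu => ?_).trans (Finset.card_union_le _ _)
  simp only [Finset.mem_union, Finset.mem_filter, Finset.mem_univ, true_and] at hu ⊢
  by_contra! h
  exact hu (by rw [Pi.add_apply, h.1, h.2, add_zero])

theorem dotProduct_congr_on {h f g : U → Bool} (hX : ∀ u ∉ X, h u = 0)
    (hfg : ∀ u ∈ X, f u = g u) : h ⬝ᵥ f = h ⬝ᵥ g := by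
  refine Finset.sum_congr rfl fun u _ => ?_
  by_cases hu : u ∈ X
  · rw [hfg u hu]
  · simp [hX u hu]

/-- By expansion the only combination of at most `r` rows that vanishes is the trivial one, so no
contradiction `0 = 1` can be derived. -/
theorem LocallyConsistent.empty (hA : Expands A r) :
    LocallyConsistent A d r f ∅ := by
  intro y hy h
  have h0 : y ᵥ* A = 0 := funext fun u => h u (by simp)
  have h1 := hA y hy
  rw [h0, hammingNorm_zero, mul_zero, Nat.le_zero, hammingNorm_eq_zero] at h1
  simp [h1]

/-- If some short combination `y` within `insert x X` involves `x`, it dictates the value at `x`.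
Any other such `z` agrees with this choice because `x` cancels in `y + z`. That sum may use `2 * r`
rows, but it is supported in `X`, so expansion bounds it by `2 * X.card ≤ r` rows and the
consistency on `X` applies. -/
theorem LocallyConsistent.exists_insert [DecidableEq U] (hA : Expands A (2 * r)) (hX : 2 * X.card ≤ r)
    (hf : LocallyConsistent A d r f X) (x : U) :
    ∃ f' : U → Bool, (∀ u ∈ X, f' u = f u) ∧ LocallyConsistent A d r f' (insert x X) := by
  by_cases hx : x ∈ X
  · exact ⟨f, fun _ _ => rfl, by rwa [Finset.insert_eq_of_mem hx]⟩
  have hsupp : ∀ y : E → Bool, (∀ u ∉ insert x X, (y ᵥ* A) u = 0) → (y ᵥ* A) x = 0 →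
      ∀ u ∉ X, (y ᵥ* A) u = 0 := by
    intro y hy hyx u hu
    by_cases hux : u = x
    · rwa [hux]
    · exact hy u (by simp [hux, hu])
  by_cases hex : ∃ y : E → Bool, hammingNorm y ≤ r ∧ (∀ u ∉ insert x X, (y ᵥ* A) u = 0) ∧
      (y ᵥ* A) x ≠ 0
  · obtain ⟨y, hyr, hyX, hyx⟩ := hex
    have hone : ∀ c : Bool, c ≠ 0 → c = 1 := by decide
    have key : ∃ f' : U → Bool, (∀ u ∈ X, f' u = f u) ∧ (y ᵥ* A) ⬝ᵥ f' = y ⬝ᵥ d := by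
      by_cases h : (y ᵥ* A) ⬝ᵥ f = y ⬝ᵥ d
      · exact ⟨f, fun _ _ => rfl, h⟩
      -- The equation `y` fails for `f`, so flip the value at `x`.
      · refine ⟨f + Pi.single x 1, fun u hu => ?_, ?_⟩
        · have : u ≠ x := fun h => hx (h ▸ hu)
          simp [this]
        · rw [dotProduct_add, dotProduct_single, hone _ hyx, mul_one]
          exact (by decide : ∀ a b : Bool, a ≠ b → a + 1 = b) _ _ h
    obtain ⟨f', hf', hyf⟩ := key
    refine ⟨f', hf', fun z hzr hzX => ?_⟩
    by_cases hzx : (z ᵥ* A) x = 0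
    · have hz := hsupp z hzX hzx
      rw [dotProduct_congr_on hz hf']
      exact hf z hzr hz
    · have hs : ∀ u ∉ X, ((y + z) ᵥ* A) u = 0 := by
        refine hsupp _ (fun u hu => ?_) ?_
        · rw [Matrix.add_vecMul, Pi.add_apply, hyX u hu, hzX u hu, add_zero]
        · rw [Matrix.add_vecMul, Pi.add_apply, hone _ hyx, hone _ hzx]
          rfl
      have hn : hammingNorm (y + z) ≤ 2 * r := by
        refine (hammingNorm_add_le y z).trans ?_
        omega
      have hn' : hammingNorm (y + z) ≤ r :=
        (hA _ hn).trans ((Nat.mul_le_mul_left 2 (hammingNorm_le_card hs)).trans hX)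
      have h1 := hf _ hn' hs
      rw [← dotProduct_congr_on hs hf', Matrix.add_vecMul, add_dotProduct, add_dotProduct,
        hyf] at h1
      exact add_left_cancel h1
  · push Not at hex
    exact ⟨f, fun _ _ => rfl, fun z hzr hzX => hf z hzr (hsupp z hzX (hex z hzr hzX))⟩

theorem LocallyConsistent.exists_union [DecidableEq U] (hA : Expands A (2 * r))
    (hf : LocallyConsistent A d r f X) (T : Finset U) (hX : 2 * (X ∪ T).card ≤ r) :
    ∃ f' : U → Bool, (∀ u ∈ X, f' u = f u) ∧ LocallyConsistent A d r f' (X ∪ T) := by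
  induction T using Finset.induction_on with
  | empty => exact ⟨f, fun _ _ => rfl, by simpa using hf⟩
  | insert x T _ ih =>
    have hle : (X ∪ T).card ≤ (X ∪ insert x T).card :=
      Finset.card_le_card (Finset.union_subset_union_right (Finset.subset_insert x T))
    obtain ⟨f₁, hf₁, hc₁⟩ := ih (by omega)
    obtain ⟨f₂, hf₂, hc₂⟩ := hc₁.exists_insert hA (by omega) x
    refine ⟨f₂, fun u hu => ?_, by rwa [Finset.union_insert]⟩
    rw [hf₂ u (Finset.mem_union_left _ hu), hf₁ u hu]

theorem exists_locallyConsistent [DecidableEq U] (hA : Expands A (2 * r)) (d : E → Bool) (T : Finset U)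
    (hT : 2 * T.card ≤ r) : ∃ f : U → Bool, LocallyConsistent A d r f T := by
  have h0 : LocallyConsistent A d r (0 : U → Bool) ∅ :=
    LocallyConsistent.empty fun y hy => hA y (by omega)
  obtain ⟨f, -, hf⟩ := h0.exists_union hA T (by simpa using hT)
  exact ⟨f, by simpa using hf⟩

theorem LocallyConsistent.mulVec_eq [DecidableEq E] (hf : LocallyConsistent A d r f X)
    (hr : 1 ≤ r) {e : E} (he : ∀ u ∉ X, A e u = 0) : (A *ᵥ f) e = d e := by
  have h := hf (Pi.single e 1) ?_ ?_
  · rwa [Matrix.single_one_vecMul, single_one_dotProduct] at h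
  · refine (hammingNorm_le_card (X := {e}) fun u hu => ?_).trans (by simpa using hr)
    exact Pi.single_eq_of_ne (by simpa using hu) _
  · simpa [Matrix.single_one_vecMul] using he

end ParitySystem

/-! ### Duplicator's strategy from local solutions -/

namespace CountingLogic

open ParitySystem

/-- If the shifts by locally consistent solutions of an expanding parity system act as partial
isomorphisms from `A` to `B`, then `A` and `B` are `C^k`-equivalent for small `k`. -/
theorem ckEquiv_of_shift {L : FirstOrder.Language.{0, 0}} [L.IsRelational]
    {E U : Type} [Fintype E] [Fintype U] [DecidableEq U] {M : Matrix E U Bool} {d : E → Bool}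
    {r k : ℕ} (hM : Expands M (2 * r)) (hk : 6 * k ≤ r) (A B : FinStr L)
    (act : (U → Bool) → A.carrier ≃ B.carrier)
    (suppA : A.carrier → Finset U) (suppB : B.carrier → Finset U)
    (hsupp : ∀ f a, suppB (act f a) = suppA a)
    (hcongr : ∀ f g a, (∀ u ∈ suppA a, f u = g u) → act f a = act g a)
    (hcard : ∀ a, (suppA a).card ≤ 3)
    (hrel : ∀ f X, LocallyConsistent M d r f X → ∀ (l : ℕ) (R : L.Relations l)
      (a : Fin l → A.carrier), 0 < l → (∀ i, suppA (a i) ⊆ X) → 1 ≤ r →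
      (FirstOrder.Language.Structure.RelMap R a ↔
        FirstOrder.Language.Structure.RelMap R (fun i => act f (a i))))
    (hL : IsEmpty (L.Relations 0)) :
    CkEquiv k A B := by
  let X (v : Fin k → A.carrier) : Finset U := Finset.univ.biUnion fun i => suppA (v i)
  -- Winning positions: one locally consistent `f` shifts all pebbles of `A` to those of `B`. At
  -- most `3 * k` vertices are involved, whence the requirement `6 * k ≤ r`.
  let P (v : Fin k → A.carrier) (w : Fin k → B.carrier) : Prop :=
    ∃ f, LocallyConsistent M d r f (X v) ∧ ∀ i, w i = act f (v i)
  have hX (s : Finset (Fin k)) (v : Fin k → A.carrier) :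
      (s.biUnion fun i => suppA (v i)).card ≤ s.card * 3 :=
    Finset.card_biUnion_le_card_mul _ _ _ fun i _ => hcard _
  have main (φ : CFormula L k) : ∀ v w, P v w → (φ.Realize v ↔ φ.Realize w) := by
    refine CFormula.realize_iff_of_bijective_game P ?_ ?_ ?_ φ
    · rintro v w ⟨f, -, hw⟩ x y
      rw [hw, hw, (act f).apply_eq_iff_eq]
    · rintro v w ⟨f, hf, hw⟩ l R xs
      have hl : 0 < l := by
        rcases Nat.eq_zero_or_pos l with rfl | h
        · exact (hL.false R).elim
        · exact h
      have hk0 : 0 < k := (Nat.zero_le _).trans_lt (xs ⟨0, hl⟩).2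
      simp only [hw]
      exact hrel f _ hf l R _ hl
        (fun i => Finset.subset_biUnion_of_mem (fun i => suppA (v i)) (Finset.mem_univ _))
        (by omega)
    · rintro v w ⟨f, hf, hw⟩ x
      let X' : Finset U := (Finset.univ.erase x).biUnion fun i => suppA (v i)
      have hX' : X' ⊆ X v := Finset.biUnion_subset_biUnion_of_subset_left _ (Finset.subset_univ _)
      have hXc : X'.card ≤ (k - 1) * 3 := by
        refine (hX _ v).trans ?_
        rw [Finset.card_erase_of_mem (Finset.mem_univ _), Finset.card_univ, Fintype.card_fin]
      have hk0 : 0 < k := (Nat.zero_le _).trans_lt x.2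
      -- The extension is chosen per support `T`, not per element: elements with the same image have
      -- the same support, hence are moved by the same shift. This makes Duplicator's answer
      -- injective.
      have hext (T : Finset U) : ∃ f' : U → Bool, T.card ≤ 3 →
          (∀ u ∈ X', f' u = f u) ∧ LocallyConsistent M d r f' (X' ∪ T) := by
        by_cases hT : T.card ≤ 3
        · have := Finset.card_union_le X' T
          obtain ⟨f', h⟩ := (hf.mono hX').exists_union hM T (by omega)
          exact ⟨f', fun _ => h⟩
        · exact ⟨f, fun h => absurd h hT⟩
      choose F hF using hext
      have hinj : Function.Injective fun a => act (F (suppA a)) a := by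
        intro a a' h
        have hs : suppA a = suppA a' := by
          rw [← hsupp (F (suppA a)) a, ← hsupp (F (suppA a')) a']
          exact congrArg suppB h
        simp only [hs] at h
        exact (act _).injective h
      have := Fintype.ofFinite A.carrier
      have := Fintype.ofFinite B.carrier
      have hbij := (Fintype.bijective_iff_injective_and_card _).2
        ⟨hinj, Fintype.card_congr (act 0)⟩
      refine ⟨Equiv.ofBijective _ hbij, fun a => ⟨F (suppA a), ?_, fun i => ?_⟩⟩
      · refine (hF _ (hcard a)).2.mono fun u hu => ?_
        obtain ⟨i, -, hi⟩ := Finset.mem_biUnion.1 hu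
        by_cases hix : i = x
        · subst hix
          rw [Function.update_self] at hi
          exact Finset.mem_union_right _ hi
        · rw [Function.update_of_ne hix] at hi
          exact Finset.mem_union_left _ (Finset.mem_biUnion.2 ⟨i, by simp [hix], hi⟩)
      · by_cases hix : i = x
        · subst hix
          simp
        · rw [Function.update_of_ne hix, Function.update_of_ne hix, hw]
          refine hcongr _ _ _ fun u hu => ((hF _ (hcard a)).1 u ?_).symm
          exact Finset.mem_biUnion.2 ⟨i, by simp [hix], hu⟩
  have huniv (v : Fin k → A.carrier) : ∃ f, LocallyConsistent M d r f (X v) := by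
    refine exists_locallyConsistent hM d _ ?_
    have := hX Finset.univ v
    rw [Finset.card_univ, Fintype.card_fin] at this
    change 2 * (Finset.univ.biUnion fun i => suppA (v i)).card ≤ r
    omega
  intro φ _
  constructor
  · intro h w
    -- The supports of the preimages of `w` do not depend on the shift, so `act 0` finds them before
    -- `f` is chosen.
    obtain ⟨f, hf⟩ := huniv fun i => (act 0).symm (w i)
    refine (main φ (fun i => (act f).symm (w i)) w ⟨f, ?_, fun i => by simp⟩).1 (h _)
    have : X (fun i => (act f).symm (w i)) = X (fun i => (act 0).symm (w i)) := by
      refine Finset.biUnion_congr rfl fun i _ => ?_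
      rw [← hsupp f, ← hsupp 0, Equiv.apply_symm_apply, Equiv.apply_symm_apply]
    rwa [this]
  · intro h v
    obtain ⟨f, hf⟩ := huniv v
    exact (main φ v (fun i => act f (v i)) ⟨f, hf, fun _ => rfl⟩).2 (h _)

end CountingLogic

/-! ### The 3SAT instance of a parity system -/

namespace ThreeSAT

open CountingLogic ParitySystem

variable {E W : Type}

/-- The system of parity equations whose row `e` has its three ones at the vertices `(i, p e i)`. -/
def parityMatrix [DecidableEq W] (p : E → Fin 3 → W) : Matrix E (Fin 3 × W) Bool :=
  fun e u => if p e u.1 = u.2 then 1 else 0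

/-- The 3SAT instance obtained from the parity equations `∑ i, x (i, p e i) = b e` by giving every
variable `x u` two copies `(u, 0)` and `(u, 1)`, the second of which stands for `x u + 1`,
and replacing each equation between copies by four clauses. -/
@[reducible]
def parityInstance [Finite E] [Finite W] (p : E → Fin 3 → W) (b : E → Bool) : Instance where
  Var := (Fin 3 × W) × Bool
  Con := E × (Fin 3 → Bool) × Bool × Bool
  sign j := ![j.2.2.1, j.2.2.2, j.2.2.1 + j.2.2.2 + (b j.1 + ∑ i, j.2.1 i)]
  vars j := ⟨fun i => ((i, p j.1 i), j.2.1 i), fun i i' h => by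
    simp only [Prod.mk.injEq] at h
    exact h.1.1⟩

/-- Exchange of the copies of the variables at which `f` is one. -/
def shiftVar (f : Fin 3 × W → Bool) : Equiv.Perm ((Fin 3 × W) × Bool) :=
  Function.Involutive.toPerm (fun x => (x.1, x.2 + f x.1)) fun x => by
    refine Prod.ext rfl ?_
    change x.2 + f x.1 + f x.1 = x.2
    rw [add_assoc, BooleanRing.add_self, add_zero]

/-- The action on clauses of the exchange of copies of variables. -/
def shiftCon (p : E → Fin 3 → W) (f : Fin 3 × W → Bool) :
    Equiv.Perm (E × (Fin 3 → Bool) × Bool × Bool) :=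
  Function.Involutive.toPerm (fun j => (j.1, (fun i => j.2.1 i + f (i, p j.1 i)), j.2.2))
    fun j => by
      have h : ∀ a c : Bool, a + c + c = a := by decide
      simp only [h]

@[simp]
theorem shiftVar_apply (f : Fin 3 × W → Bool) (x) : shiftVar f x = (x.1, x.2 + f x.1) := rfl

@[simp]
theorem shiftCon_apply (p : E → Fin 3 → W) (f : Fin 3 × W → Bool) (j) :
    shiftCon p f j = (j.1, (fun i => j.2.1 i + f (i, p j.1 i)), j.2.2) := rfl

theorem shiftVar_congr {f g : Fin 3 × W → Bool} {x : (Fin 3 × W) × Bool} (h : f x.1 = g x.1) :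
    shiftVar f x = shiftVar g x := by
  rw [shiftVar_apply, shiftVar_apply, h]

theorem shiftCon_congr {p : E → Fin 3 → W} {f g : Fin 3 × W → Bool}
    {j : E × (Fin 3 → Bool) × Bool × Bool} (h : ∀ i, f (i, p j.1 i) = g (i, p j.1 i)) :
    shiftCon p f j = shiftCon p g j := by
  simp only [shiftCon_apply, h]

variable [Finite E] [Finite W]

/-- The sign pattern sees `b` and the chosen copies only through the sum of `b j.1` and the copy
indices; the shift changes the latter by `b j.1 + b' j.1`, which compensates exactly for replacing
`b` by `b'`. -/
theorem sign_shiftCon (p : E → Fin 3 → W) (b b' : E → Bool) (f : Fin 3 × W → Bool)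
    (j : E × (Fin 3 → Bool) × Bool × Bool) (h : ∑ i, f (i, p j.1 i) = b j.1 + b' j.1) :
    (parityInstance p b').sign (shiftCon p f j) = (parityInstance p b).sign j := by
  have : b' j.1 + ∑ i, (j.2.1 i + f (i, p j.1 i)) = b j.1 + ∑ i, j.2.1 i := by
    rw [Finset.sum_add_distrib, h]
    generalize b' j.1 = x
    generalize b j.1 = y
    generalize ∑ i, j.2.1 i = z
    revert x y z
    decide
  simp only [shiftCon_apply, this]

omit [Finite E] [Finite W] in
theorem parityMatrix_mulVec [Fintype W] [DecidableEq W] (p : E → Fin 3 → W)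
    (f : Fin 3 × W → Bool) (e : E) : (parityMatrix p *ᵥ f) e = ∑ i, f (i, p e i) := by
  simp [Matrix.mulVec, dotProduct, parityMatrix, Fintype.sum_prod_type]

/-- The vertices occurring in a parity equation. -/
def rowSupport [DecidableEq W] (p : E → Fin 3 → W) (e : E) : Finset (Fin 3 × W) :=
  Finset.univ.image fun i => (i, p e i)

omit [Finite E] [Finite W] in
theorem mem_rowSupport [DecidableEq W] {p : E → Fin 3 → W} {e : E} {u : Fin 3 × W} :
    u ∈ rowSupport p e ↔ p e u.1 = u.2 := by
  simp only [rowSupport, Finset.mem_image, Finset.mem_univ, true_and]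
  constructor
  · rintro ⟨i, rfl⟩
    rfl
  · intro h
    exact ⟨u.1, by rw [h]⟩

omit [Finite E] [Finite W] in
theorem rowSupport_card_le [DecidableEq W] (p : E → Fin 3 → W) (e : E) :
    (rowSupport p e).card ≤ 3 :=
  Finset.card_image_le.trans (by simp)

omit [Finite E] [Finite W] in
theorem sum_eq_of_locallyConsistent [Fintype E] [Fintype W] [DecidableEq W] {p : E → Fin 3 → W}
    {d : E → Bool} {r : ℕ} {f : Fin 3 × W → Bool} {X : Finset (Fin 3 × W)}
    (hf : LocallyConsistent (parityMatrix p) d r f X) (hr : 1 ≤ r) {e : E}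
    (he : rowSupport p e ⊆ X) : ∑ i, f (i, p e i) = d e := by
  classical
  rw [← parityMatrix_mulVec]
  refine hf.mulVec_eq hr fun u hu => if_neg fun h => hu (he (mem_rowSupport.2 h))

/-- The first encoding as a finite structure. -/
@[reducible]
def finStr₁ (I : Instance) [Nonempty I.Var] : FinStr L₁ where
  carrier := Enc₁ I
  fin := by
    have := I.finVar
    have := I.finCon
    exact inferInstanceAs (Finite (I.Var ⊕ I.Con))
  ne := inferInstanceAs (Nonempty (I.Var ⊕ I.Con))

/-- The second encoding as a finite structure. -/
@[reducible]
def finStr₂ (I : Instance) [Nonempty I.Var] : FinStr L₂ where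
  carrier := Enc₂ I
  fin := I.finVar
  ne := inferInstanceAs (Nonempty I.Var)

/-- A related triple covers all three vertices of its equation, so local consistency forces `f` to
solve that equation. -/
theorem ckEquiv_finStr₂ [Fintype E] [Fintype W] [DecidableEq W] [Nonempty W]
    (p : E → Fin 3 → W) (b b' : E → Bool) {r k : ℕ} (hp : Expands (parityMatrix p) (2 * r))
    (hk : 6 * k ≤ r) :
    CkEquiv k (finStr₂ (parityInstance p b)) (finStr₂ (parityInstance p b')) := by
  refine ckEquiv_of_shift (d := b + b') hp hk _ _ (fun f => shiftVar f) (fun x => {x.1})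
    (fun x => {x.1}) ?_ ?_ ?_ ?_ ?_
  · intro f x
    rfl
  · intro f g x h
    exact shiftVar_congr (h x.1 (Finset.mem_singleton_self _))
  · intro x
    simp
  · intro f X hf l R x _ hx hr
    rcases R with ⟨s⟩
    have hsum (j : E × (Fin 3 → Bool) × Bool × Bool) (h : ∀ i, (i, p j.1 i) = (x i).1) :
        ∑ i, f (i, p j.1 i) = b j.1 + b' j.1 := by
      refine sum_eq_of_locallyConsistent hf hr fun u hu => ?_
      obtain ⟨i, -, rfl⟩ := Finset.mem_image.1 hu
      exact hx i (Finset.mem_singleton.2 (h i))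
    constructor
    · rintro ⟨j, hs, hj⟩
      refine ⟨shiftCon p f j, ?_, fun i => congrArg (shiftVar f) (hj i)⟩
      rw [← hs]
      exact sign_shiftCon p b b' f j (hsum j fun i => congrArg Prod.fst (hj i))
    · rintro ⟨j, hs, hj⟩
      obtain ⟨j, rfl⟩ := (shiftCon p f).surjective j
      refine ⟨j, ?_, fun i => (shiftVar f).injective (hj i)⟩
      rw [← hs]
      exact (sign_shiftCon p b b' f j (hsum j fun i => congrArg Prod.fst (hj i))).symm
  · exact ⟨fun R => nomatch R⟩

/-- A clause is supported on all three vertices of its equation. The incidences `E i` survive every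
shift; only the types `Z s` need `f` to solve the equation. -/
theorem ckEquiv_finStr₁ [Fintype E] [Fintype W] [DecidableEq W] [Nonempty W]
    (p : E → Fin 3 → W) (b b' : E → Bool) {r k : ℕ} (hp : Expands (parityMatrix p) (2 * r))
    (hk : 6 * k ≤ r) :
    CkEquiv k (finStr₁ (parityInstance p b)) (finStr₁ (parityInstance p b')) := by
  refine ckEquiv_of_shift (d := b + b') hp hk _ _
    (fun f => Equiv.sumCongr (shiftVar f) (shiftCon p f))
    (Sum.elim (fun x => {x.1}) fun j => rowSupport p j.1)
    (Sum.elim (fun x => {x.1}) fun j => rowSupport p j.1) ?_ ?_ ?_ ?_ ?_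
  · rintro f (x | j) <;> rfl
  · rintro f g (x | j) h
    · exact congrArg Sum.inl (shiftVar_congr (h x.1 (Finset.mem_singleton_self _)))
    · exact congrArg Sum.inr (shiftCon_congr fun i => h (i, p j.1 i) (mem_rowSupport.2 rfl))
  · rintro (x | j)
    · exact (Finset.card_singleton _).le.trans (by norm_num)
    · exact rowSupport_card_le p j.1
  · intro f X hf l R x _ hx hr
    let σ : Enc₁ (parityInstance p b) ≃ Enc₁ (parityInstance p b') :=
      Equiv.sumCongr (shiftVar f) (shiftCon p f)
    rcases R with ⟨i⟩ | ⟨s⟩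
    · constructor
      · rintro ⟨j, h0, h1⟩
        exact ⟨shiftCon p f j, congrArg σ h0, congrArg σ h1⟩
      · rintro ⟨j, h0, h1⟩
        obtain ⟨j, rfl⟩ := (shiftCon p f).surjective j
        exact ⟨j, σ.injective h0, σ.injective h1⟩
    · have hsum (j : E × (Fin 3 → Bool) × Bool × Bool) (h : x 0 = Sum.inr j) :
          ∑ i, f (i, p j.1 i) = b j.1 + b' j.1 := by
        refine sum_eq_of_locallyConsistent hf hr ?_
        have := hx 0
        rwa [h] at this
      constructor
      · rintro ⟨j, h0, h1⟩
        refine ⟨shiftCon p f j, congrArg σ h0, ?_⟩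
        rw [← h1]
        exact sign_shiftCon p b b' f j (hsum j h0)
      · rintro ⟨j, h0, h1⟩
        obtain ⟨j, rfl⟩ := (shiftCon p f).surjective j
        refine ⟨j, σ.injective h0, ?_⟩
        rw [← h1]
        exact (sign_shiftCon p b b' f j (hsum j (σ.injective h0))).symm
  · exact ⟨fun R => nomatch R⟩

theorem parityInstance_zero_satisfiable (p : E → Fin 3 → W) :
    (parityInstance p 0).Satisfiable := by
  -- This is the zero solution: copy `(u, a)` stands for `x u + a`.
  refine ⟨fun x => x.2, fun j => ?_⟩
  change ∃ i : Fin 3, j.2.1 i =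
    (![j.2.2.1, j.2.2.2, j.2.2.1 + j.2.2.2 + (0 + ∑ i, j.2.1 i)] : Fin 3 → Bool) i
  generalize j.2.2.1 = s
  generalize j.2.2.2 = t
  generalize j.2.1 = a
  revert s t a
  decide

theorem parityInstance_isSimple (p : E → Fin 3 → W) (b : E → Bool) (hp : Function.Injective p) :
    (parityInstance p b).IsSimple := by
  rintro ⟨e, a, s, t⟩ ⟨e', a', s', t'⟩ h
  obtain ⟨hs, hv⟩ := Prod.mk.inj h
  have hv' (i : Fin 3) : ((i, p e i), a i) = ((i, p e' i), a' i) := DFunLike.congr_fun hv i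
  have he : e = e' := hp (funext fun i => congrArg (fun x => x.1.2) (hv' i))
  have ha : a = a' := funext fun i => congrArg (fun x => x.2) (hv' i)
  have h0 : s = s' := congrFun hs 0
  have h1 : t = t' := congrFun hs 1
  rw [he, ha, h0, h1]

-- Two equal rows would sum to zero, against expansion. This keeps clauses from repeating in the
-- second encoding.
omit [Finite E] [Finite W] in
theorem injective_of_expands [Fintype E] [Fintype W] [DecidableEq W] {p : E → Fin 3 → W} {r : ℕ}
    (hp : Expands (parityMatrix p) r) (hr : 2 ≤ r) : Function.Injective p := by
  classical
  intro e e' h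
  by_contra hne
  have hn : hammingNorm (Pi.single e 1 + Pi.single e' 1 : E → Bool) ≤ r := by
    refine (hammingNorm_le_card (X := {e, e'}) fun u hu => ?_).trans
      (Finset.card_le_two.trans hr)
    simp only [Finset.mem_insert, Finset.mem_singleton, not_or] at hu
    simp [hu.1, hu.2]
  have h0 : (Pi.single e 1 + Pi.single e' 1 : E → Bool) ᵥ* parityMatrix p = 0 := by
    rw [Matrix.add_vecMul, Matrix.single_one_vecMul, Matrix.single_one_vecMul]
    have : parityMatrix p e = parityMatrix p e' := by
      funext u
      simp [parityMatrix, h]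
    change parityMatrix p e + parityMatrix p e' = 0
    rw [this]
    funext u
    exact BooleanRing.add_self _
  have h1 := hp _ hn
  rw [h0, hammingNorm_zero, mul_zero, Nat.le_zero, hammingNorm_eq_zero] at h1
  have := congrFun h1 e
  simp [hne] at this

end ThreeSAT

/-! ### A Chernoff bound -/

/-- A Chernoff and union bound: a family of fewer than `exp (t² m / 2)` sums of `m` bounded
symmetric random signs has an outcome at which all the sums are below `t m`. -/
theorem exists_forall_sum_lt_of_card_lt_exp {E G : Type} [Fintype E] [Fintype G]
    (Y : G → E → Bool → ℝ) (habs : ∀ g e, |Y g e true| ≤ 1)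
    (hneg : ∀ g e, Y g e false = -Y g e true) {t : ℝ} (ht : 0 ≤ t)
    (hcard : (Fintype.card G : ℝ) < Real.exp (t ^ 2 * Fintype.card E / 2)) :
    ∃ b : E → Bool, ∀ g, ∑ e, Y g e (b e) < t * Fintype.card E := by
  classical
  by_contra! h
  -- Exponential moments with parameter `t`, summed over all `b` and `g`: from below by one bad `g`
  -- for each `b`, from above by independence and `cosh x ≤ exp (x² / 2)`.
  have hlow : (2 : ℝ) ^ Fintype.card E * Real.exp (t * (t * Fintype.card E)) ≤
      ∑ b : E → Bool, ∑ g, Real.exp (t * ∑ e, Y g e (b e)) := by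
    have hc : ((2 : ℝ) ^ Fintype.card E) = (Finset.univ : Finset (E → Bool)).card := by
      simp
    rw [hc, ← nsmul_eq_mul]
    refine Finset.card_nsmul_le_sum _ _ _ fun b _ => ?_
    obtain ⟨g, hg⟩ := h b
    refine le_trans ?_ (Finset.single_le_sum (f := fun g => Real.exp (t * ∑ e, Y g e (b e)))
      (fun g _ => (Real.exp_pos _).le) (Finset.mem_univ g))
    exact Real.exp_le_exp.2 (mul_le_mul_of_nonneg_left hg ht)
  have hup : ∑ b : E → Bool, ∑ g, Real.exp (t * ∑ e, Y g e (b e)) ≤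
      Fintype.card G * ((2 : ℝ) ^ Fintype.card E * Real.exp (t ^ 2 * Fintype.card E / 2)) := by
    rw [Finset.sum_comm, ← nsmul_eq_mul, ← Finset.card_univ]
    refine Finset.sum_le_card_nsmul _ _ _ fun g _ => ?_
    have h1 : ∑ b : E → Bool, Real.exp (t * ∑ e, Y g e (b e)) =
        ∏ e, ∑ c : Bool, Real.exp (t * Y g e c) := by
      rw [Finset.prod_univ_sum, Fintype.piFinset_univ]
      exact Finset.sum_congr rfl fun b _ => by rw [Finset.mul_sum, Real.exp_sum]
    have h2 : (2 : ℝ) ^ Fintype.card E * Real.exp (t ^ 2 * Fintype.card E / 2) =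
        ∏ _e : E, 2 * Real.exp (t ^ 2 / 2) := by
      rw [Finset.prod_const, Finset.card_univ, mul_pow, ← Real.exp_nat_mul]
      congr 2
      ring
    rw [h1, h2]
    refine Finset.prod_le_prod (fun e _ => Finset.sum_nonneg fun c _ => (Real.exp_pos _).le)
      fun e _ => ?_
    rw [Fintype.sum_bool, hneg, mul_neg]
    have h3 := Real.cosh_le_exp_half_sq (t * Y g e true)
    rw [Real.cosh_eq] at h3
    have h4 : Real.exp ((t * Y g e true) ^ 2 / 2) ≤ Real.exp (t ^ 2 / 2) := by
      refine Real.exp_le_exp.2 ?_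
      have : Y g e true ^ 2 ≤ 1 := (sq_le_one_iff_abs_le_one _).2 (habs g e)
      nlinarith [sq_nonneg t]
    linarith
  have hsplit : Real.exp (t * (t * Fintype.card E)) =
      Real.exp (t ^ 2 * Fintype.card E / 2) * Real.exp (t ^ 2 * Fintype.card E / 2) := by
    rw [← Real.exp_add]
    congr 1
    ring
  have hpos := Real.exp_pos (t ^ 2 * Fintype.card E / 2)
  have h2pos : (0 : ℝ) < 2 ^ Fintype.card E := by positivity
  have := hlow.trans hup
  rw [hsplit] at this
  have h5 := mul_lt_mul_of_pos_right hcard (mul_pos h2pos hpos)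
  linarith

/-! ### Inapproximability for a random right-hand side -/

namespace ThreeSAT

/-- The real sign `(-1) ^ c`. -/
def boolSign (c : Bool) : ℝ := if c then -1 else 1

variable {E W : Type} [Fintype E] [Fintype W]

/-- The average, over the eight choices of copies of its variables, of the sign saying whether the
assignment `g` satisfies the equation `e` with right-hand side `c`. -/
noncomputable def equationBias (p : E → Fin 3 → W) (g : (Fin 3 × W) × Bool → Bool) (e : E)
    (c : Bool) : ℝ :=
  (∑ a : Fin 3 → Bool, boolSign (c + ∑ i, (g ((i, p e i), a i) + a i))) / 8

omit [Fintype E] [Fintype W] in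
theorem equationBias_false (p : E → Fin 3 → W) (g : (Fin 3 × W) × Bool → Bool) (e : E) :
    equationBias p g e false = -equationBias p g e true := by
  rw [equationBias, equationBias, ← neg_div, ← Finset.sum_neg_distrib]
  congr 1
  refine Finset.sum_congr rfl fun a _ => ?_
  generalize ∑ i, (g ((i, p e i), a i) + a i) = x
  cases x <;> simp [boolSign, show true + true = false from rfl, show true + false = true from rfl,
    show false + true = true from rfl, show false + false = false from rfl]

omit [Fintype E] [Fintype W] in
theorem abs_equationBias_le (p : E → Fin 3 → W) (g : (Fin 3 × W) × Bool → Bool) (e : E)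
    (c : Bool) : |equationBias p g e c| ≤ 1 := by
  rw [equationBias, abs_div, abs_of_pos (by norm_num : (0 : ℝ) < 8), div_le_one (by norm_num)]
  refine (Finset.abs_sum_le_sum_abs _ _).trans ?_
  refine (Finset.sum_le_card_nsmul _ _ 1 fun a _ => ?_).trans (by simp)
  unfold boolSign
  split_ifs <;> simp

/-- The four clauses have the sign patterns of one fixed parity. A clause fails only when `g` is the
complement of its pattern, so at most one fails, and one does exactly when the parity equation is
violated. -/
theorem card_holds_copies (g : Fin 3 → Bool) (a : Fin 3 → Bool) (c : Bool) :
    (((Finset.univ : Finset (Bool × Bool)).filter fun s =>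
      ∃ i, g i = (![s.1, s.2, s.1 + s.2 + (c + ∑ i, a i)] : Fin 3 → Bool) i).card : ℝ) =
      7 / 2 + boolSign (c + ∑ i, (g i + a i)) / 2 := by
  have h : ∀ (g : Fin 3 → Bool) (x : Bool),
      ((Finset.univ : Finset (Bool × Bool)).filter fun s =>
        ∃ i, g i = (![s.1, s.2, s.1 + s.2 + x] : Fin 3 → Bool) i).card =
      if x + ∑ i, g i then 3 else 4 := by decide
  rw [h, Finset.sum_add_distrib, add_assoc, add_comm (∑ i, a i), boolSign]
  split_ifs <;> norm_num

theorem card_holds_parityInstance (p : E → Fin 3 → W) (b : E → Bool)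
    (g : (Fin 3 × W) × Bool → Bool) :
    (Nat.card {j : (parityInstance p b).Con // (parityInstance p b).Holds g j} : ℝ) =
      28 * Fintype.card E + 4 * ∑ e, equationBias p g e (b e) := by
  classical
  have h1 : Nat.card {j : (parityInstance p b).Con // (parityInstance p b).Holds g j} =
      ∑ e : E, ∑ a : Fin 3 → Bool, ((Finset.univ : Finset (Bool × Bool)).filter fun s =>
        ∃ i, g ((i, p e i), a i) =
          (![s.1, s.2, s.1 + s.2 + (b e + ∑ i, a i)] : Fin 3 → Bool) i).card := by
    change Nat.card {j : E × (Fin 3 → Bool) × Bool × Bool // ∃ i, g ((i, p j.1 i), j.2.1 i) =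
      (![j.2.2.1, j.2.2.2, j.2.2.1 + j.2.2.2 + (b j.1 + ∑ i, j.2.1 i)] : Fin 3 → Bool) i} = _
    rw [Nat.card_eq_fintype_card, Fintype.card_subtype]
    simp only [Finset.card_filter, Fintype.sum_prod_type]
  rw [h1]
  push_cast
  have h2 (e : E) : ∑ a : Fin 3 → Bool, (((Finset.univ : Finset (Bool × Bool)).filter fun s =>
        ∃ i, g ((i, p e i), a i) =
          (![s.1, s.2, s.1 + s.2 + (b e + ∑ i, a i)] : Fin 3 → Bool) i).card : ℝ) =
      28 + 4 * equationBias p g e (b e) := by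
    rw [Finset.sum_congr rfl fun a _ => card_holds_copies (fun i => g ((i, p e i), a i)) a (b e),
      Finset.sum_add_distrib, Finset.sum_const, Finset.card_univ, Fintype.card_fun,
      Fintype.card_bool, Fintype.card_fin, nsmul_eq_mul, ← Finset.sum_div, equationBias]
    push_cast
    ring
  rw [Finset.sum_congr rfl fun e _ => h2 e, Finset.sum_add_distrib, ← Finset.mul_sum]
  simp
  ring

theorem exists_not_cSatisfiable (p : E → Fin 3 → W) {ε : ℝ} (hε : 0 < ε)
    (h : 6 * (Fintype.card W : ℝ) < 32 * ε ^ 2 * Fintype.card E) :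
    ∃ b : E → Bool, ¬ (parityInstance p b).CSatisfiable (7 / 8 + ε) := by
  classical
  have hcard : (Fintype.card ((Fin 3 × W) × Bool → Bool) : ℝ) <
      Real.exp ((8 * ε) ^ 2 * Fintype.card E / 2) := by
    have hc : Fintype.card ((Fin 3 × W) × Bool → Bool) = 2 ^ (6 * Fintype.card W) := by
      simp only [Fintype.card_fun, Fintype.card_prod, Fintype.card_bool, Fintype.card_fin]
      congr 1
      ring
    rw [hc]
    push_cast
    have h2 : (2 : ℝ) ≤ Real.exp 1 := by
      have := Real.add_one_le_exp (1 : ℝ)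
      linarith
    calc (2 : ℝ) ^ (6 * Fintype.card W) ≤ Real.exp 1 ^ (6 * Fintype.card W) := by gcongr
      _ = Real.exp (6 * Fintype.card W) := by
        rw [← Real.exp_nat_mul]
        push_cast
        ring_nf
      _ < _ := Real.exp_lt_exp.2 (by nlinarith)
  -- With `t = 8 * ε` and `m` equations, fewer than `28 * m + 4 * (8 * ε * m)` of the `32 * m`
  -- clauses hold, a fraction below `7 / 8 + ε`.
  obtain ⟨b, hb⟩ := exists_forall_sum_lt_of_card_lt_exp (equationBias p)
    (fun g e => abs_equationBias_le p g e true) (equationBias_false p) (by positivity) hcard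
  refine ⟨b, fun ⟨g, hg⟩ => ?_⟩
  rw [card_holds_parityInstance] at hg
  have hc : Nat.card (parityInstance p b).Con = Fintype.card E * 32 := by
    change Nat.card (E × (Fin 3 → Bool) × Bool × Bool) = _
    simp
  rw [hc] at hg
  push_cast at hg
  have := hb g
  nlinarith

end ThreeSAT

/-! ### Random triple systems expand -/

namespace ThreeSAT

open ParitySystem

variable {E W : Type} [Fintype E] [Fintype W] [DecidableEq E] [DecidableEq W]

omit [DecidableEq E] in
/-- A triple system in which small sets of triples cover many vertices has an expanding parity
matrix, since many vertices are covered just once. -/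
theorem expands_of_card_biUnion (p : E → Fin 3 → W) {R : ℕ}
    (h : ∀ S : Finset E, S.card ≤ R → 7 * S.card ≤ 4 * (S.biUnion (rowSupport p)).card) :
    Expands (parityMatrix p) R := by
  intro y hy
  set S : Finset E := Finset.univ.filter fun e => y e ≠ 0 with hS
  set Γ := S.biUnion (rowSupport p) with hΓ
  have hSc : hammingNorm y = S.card := rfl
  have hSΓ := h S hy
  have hdeg : ∑ u ∈ Γ, (S.filter fun e => u ∈ rowSupport p e).card ≤ S.card * 3 := by
    simp only [Finset.card_filter]
    rw [Finset.sum_comm, ← smul_eq_mul]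
    refine Finset.sum_le_card_nsmul _ _ _ fun e _ => ?_
    rw [← Finset.card_filter]
    refine (Finset.card_le_card fun u hu => ?_).trans (rowSupport_card_le p e)
    exact (Finset.mem_filter.1 hu).2
  -- A vertex covered exactly once survives in the sum of the rows. Summing over `Γ`, at least `2 *
  -- Γ.card - 3 * S.card ≥ S.card / 2` vertices survive.
  have hpt : ∀ u ∈ Γ, 2 ≤ (S.filter fun e => u ∈ rowSupport p e).card +
      if (y ᵥ* parityMatrix p) u ≠ 0 then 1 else 0 := by
    intro u hu
    obtain ⟨e, heS, heu⟩ := Finset.mem_biUnion.1 hu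
    have hpos : 0 < (S.filter fun e => u ∈ rowSupport p e).card :=
      Finset.card_pos.2 ⟨e, Finset.mem_filter.2 ⟨heS, heu⟩⟩
    split_ifs with h0
    · omega
    · by_contra hlt
      have hone : (S.filter fun e => u ∈ rowSupport p e).card = 1 := by omega
      obtain ⟨e', he'⟩ := Finset.card_eq_one.1 hone
      have hee : e = e' := by
        have : e ∈ S.filter fun e => u ∈ rowSupport p e := Finset.mem_filter.2 ⟨heS, heu⟩
        rw [he'] at this
        exact Finset.mem_singleton.1 this
      subst hee
      have hye : y e ≠ 0 := (Finset.mem_filter.1 heS).2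
      apply h0
      have : (y ᵥ* parityMatrix p) u = y e * parityMatrix p e u := by
        refine Finset.sum_eq_single e (fun e' _ hne => ?_) (by simp)
        by_cases hy' : y e' = 0
        · simp [hy']
        · have hnot : u ∉ rowSupport p e' := fun hmem => hne <| by
            have : e' ∈ S.filter fun e => u ∈ rowSupport p e :=
              Finset.mem_filter.2 ⟨by simp [hS, hy'], hmem⟩
            rw [he'] at this
            exact Finset.mem_singleton.1 this
          rw [mem_rowSupport] at hnot
          simp [parityMatrix, hnot]
      rw [this, parityMatrix, if_pos (mem_rowSupport.1 heu), mul_one]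
      exact hye
  have hsum := Finset.sum_le_sum hpt
  rw [Finset.sum_add_distrib, Finset.sum_const, smul_eq_mul, ← Finset.card_filter] at hsum
  have hle : (Γ.filter fun u => (y ᵥ* parityMatrix p) u ≠ 0).card ≤
      hammingNorm (y ᵥ* parityMatrix p) :=
    Finset.card_le_card (Finset.filter_subset_filter _ (Finset.subset_univ _))
  change 7 * S.card ≤ 4 * Γ.card at hSΓ
  omega

theorem card_filter_rowSupport_subset_le (S : Finset E) (T : Finset (Fin 3 × W)) :
    ((Finset.univ : Finset (E → Fin 3 → W)).filter fun p => ∀ e ∈ S, rowSupport p e ⊆ T).card ≤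
      (T.card ^ 3) ^ S.card * (Fintype.card W ^ 3) ^ (Fintype.card E - S.card) := by
  let T' (i : Fin 3) : Finset W := Finset.univ.filter fun w => (i, w) ∈ T
  have hT' (i : Fin 3) : (T' i).card ≤ T.card :=
    Finset.card_le_card_of_injOn (fun w => (i, w))
      (fun w hw => (Finset.mem_filter.1 hw).2) (fun w _ w' _ h => (Prod.mk.inj h).2)
  calc _ ≤ (Fintype.piFinset fun e : E => if e ∈ S then Fintype.piFinset T' else
          (Finset.univ : Finset (Fin 3 → W))).card := by
        refine Finset.card_le_card fun p hp => ?_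
        rw [Fintype.mem_piFinset]
        intro e
        split_ifs with he
        · rw [Fintype.mem_piFinset]
          intro i
          exact Finset.mem_filter.2 ⟨Finset.mem_univ _,
            (Finset.mem_filter.1 hp).2 e he (mem_rowSupport.2 rfl)⟩
        · exact Finset.mem_univ _
    _ ≤ ∏ e : E, if e ∈ S then T.card ^ 3 else Fintype.card W ^ 3 := by
        rw [Fintype.card_piFinset]
        refine Finset.prod_le_prod' fun e _ => ?_
        split_ifs
        · rw [Fintype.card_piFinset]
          exact (Finset.prod_le_pow_card _ _ _ fun i _ => hT' i).trans (by simp)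
        · simp
    _ = _ := by
        rw [Finset.prod_ite, Finset.prod_const, Finset.prod_const, Finset.filter_mem_eq_inter,
          Finset.univ_inter, Finset.filter_not, Finset.filter_mem_eq_inter, Finset.univ_inter,
          Finset.card_sdiff_of_subset (Finset.subset_univ _), Finset.card_univ]

/-- The union bound for the existence of triple systems in which small sets of triples cover many
vertices. -/
theorem exists_card_biUnion_ge [Nonempty W] {R : ℕ} (hR : 2 * R ≤ Fintype.card W)
    (h : ∑ s ∈ Finset.Icc 1 R, ((Fintype.card E).choose s : ℝ) *
      ((3 * Fintype.card W).choose (7 * s / 4)) *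
        (((7 * s / 4 : ℕ) : ℝ) / Fintype.card W) ^ (3 * s) < 1) :
    ∃ p : E → Fin 3 → W, ∀ S : Finset E, S.card ≤ R →
      7 * S.card ≤ 4 * (S.biUnion (rowSupport p)).card := by
  by_contra! hbad
  set N := Fintype.card W with hN
  set M := Fintype.card E with hM
  have hNpos : 0 < N := Fintype.card_pos
  let B (S : Finset E) (T : Finset (Fin 3 × W)) : Finset (E → Fin 3 → W) :=
    Finset.univ.filter fun p => ∀ e ∈ S, rowSupport p e ⊆ T
  let F (s : ℕ) : Finset (E → Fin 3 → W) :=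
    (Finset.univ.powersetCard s).biUnion fun S =>
      (Finset.univ.powersetCard (7 * s / 4)).biUnion fun T => B S T
  have hcover : (Finset.univ : Finset (E → Fin 3 → W)) ⊆ (Finset.Icc 1 R).biUnion F := by
    intro p _
    obtain ⟨S, hSR, hS⟩ := hbad p
    have hU : Fintype.card (Fin 3 × W) = 3 * N := by simp [hN]
    -- Padding to size exactly `7 * s / 4` is possible since `7 * s / 4 ≤ 2 * R` is at most the
    -- number of vertices.
    obtain ⟨T, hT, hTc⟩ := Finset.exists_superset_card_eq (s := S.biUnion (rowSupport p))
      (n := 7 * S.card / 4) (by omega) (by omega)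
    refine Finset.mem_biUnion.2 ⟨S.card, Finset.mem_Icc.2 ⟨by omega, hSR⟩, ?_⟩
    refine Finset.mem_biUnion.2 ⟨S, Finset.mem_powersetCard.2 ⟨Finset.subset_univ _, rfl⟩, ?_⟩
    refine Finset.mem_biUnion.2 ⟨T, Finset.mem_powersetCard.2 ⟨Finset.subset_univ _, hTc⟩, ?_⟩
    exact Finset.mem_filter.2 ⟨Finset.mem_univ _, fun e he =>
      (Finset.subset_biUnion_of_mem _ he).trans hT⟩
  have hF (s : ℕ) : ((F s).card : ℝ) ≤ (N : ℝ) ^ (3 * M) * ((M.choose s : ℝ) *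
      ((3 * N).choose (7 * s / 4)) * (((7 * s / 4 : ℕ) : ℝ) / N) ^ (3 * s)) := by
    by_cases hs : s ≤ M
    · have h1 : (F s).card ≤ M.choose s * ((3 * N).choose (7 * s / 4) *
          (((7 * s / 4) ^ 3) ^ s * (N ^ 3) ^ (M - s))) := by
        have hc : M.choose s = ((Finset.univ : Finset E).powersetCard s).card := by
          rw [Finset.card_powersetCard, Finset.card_univ]
        rw [hc]
        refine Finset.card_biUnion_le_card_mul _ _ _ fun S hS => ?_
        have hc' : (3 * N).choose (7 * s / 4) =
            ((Finset.univ : Finset (Fin 3 × W)).powersetCard (7 * s / 4)).card := by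
          rw [Finset.card_powersetCard, Finset.card_univ]
          simp [hN]
        rw [hc']
        refine Finset.card_biUnion_le_card_mul _ _ _ fun T hT => ?_
        have := card_filter_rowSupport_subset_le S T
        rwa [(Finset.mem_powersetCard.1 hS).2, (Finset.mem_powersetCard.1 hT).2] at this
      have h2 : (N : ℝ) ^ (3 * M) = (N ^ 3) ^ (M - s) * N ^ (3 * s) := by
        rw [← pow_mul, ← pow_add]
        congr 1
        omega
      have hN0 : (N : ℝ) ≠ 0 := by exact_mod_cast hNpos.ne'
      refine (Nat.cast_le (α := ℝ).2 h1).trans (le_of_eq ?_)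
      rw [h2, div_pow]
      push_cast
      field_simp
      ring
    · have : F s = ∅ := by
        simp only [F]
        rw [Finset.powersetCard_eq_empty.2 (by rw [Finset.card_univ]; omega),
          Finset.biUnion_empty]
      rw [this, Finset.card_empty, Nat.cast_zero]
      positivity
  have htot : (N : ℝ) ^ (3 * M) ≤ ∑ s ∈ Finset.Icc 1 R, ((F s).card : ℝ) := by
    have h1 := (Finset.card_le_card hcover).trans Finset.card_biUnion_le
    have h2 : (Finset.univ : Finset (E → Fin 3 → W)).card = N ^ (3 * M) := by
      rw [Finset.card_univ]
      simp [hN, hM, pow_mul]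
    rw [h2] at h1
    exact_mod_cast h1
  have hle := htot.trans (Finset.sum_le_sum fun s _ => hF s)
  rw [← Finset.mul_sum] at hle
  have hpos : (0 : ℝ) < (N : ℝ) ^ (3 * M) := by positivity
  nlinarith

theorem choose_le_three_mul_div_pow (n t : ℕ) (ht : 0 < t) :
    (n.choose t : ℝ) ≤ (3 * n / t) ^ t := by
  have h1 := Nat.choose_le_pow_div (α := ℝ) t n
  have h2 := Real.pow_div_factorial_le_exp (t : ℝ) (by positivity) t
  have h3 : Real.exp t ≤ 3 ^ t := by
    rw [← mul_one (t : ℝ), Real.exp_nat_mul]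
    gcongr
    exact Real.exp_one_lt_three.le
  have hf : (0 : ℝ) < t.factorial := by positivity
  have ht' : (0 : ℝ) < t := by exact_mod_cast ht
  refine h1.trans ?_
  rw [div_pow, mul_pow, div_le_div_iff₀ hf (by positivity)]
  have h4 := (div_le_iff₀ hf).1 (h2.trans h3)
  calc (n : ℝ) ^ t * t ^ t ≤ n ^ t * (3 ^ t * t.factorial) := by gcongr
    _ = _ := by ring

/-- With `z = s / N`, `t = 7 * s / 4` and `x = t / N`, the binomials cost about `z ^ (-s)` and `x ^
(-t)`. Of the `3 * s` factors `x`, these absorb `s + t`; the remaining `2 * s - t ≥ s / 4` factors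
are each at most `w ^ 4` and gain `w ^ s`. The constant is `486 = 3 * 81 * 2`. -/
theorem union_bound_term_le {c N s : ℕ} (hN : 0 < N) (hs : 0 < s) {w : ℝ}
    (hw : 0 < w) (hw1 : w ≤ 1) (hsN : (s : ℝ) / N ≤ w ^ 4 / 2) :
    ((c * N).choose s : ℝ) * ((3 * N).choose (7 * s / 4)) *
      (((7 * s / 4 : ℕ) : ℝ) / N) ^ (3 * s) ≤ (486 * c * w) ^ s := by
  set t := 7 * s / 4 with ht
  have ht0 : 0 < t := by omega
  have hN' : (0 : ℝ) < N := by exact_mod_cast hN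
  have hs' : (0 : ℝ) < s := by exact_mod_cast hs
  have ht' : (0 : ℝ) < t := by exact_mod_cast ht0
  have hts : t ≤ 2 * s := by omega
  set z : ℝ := s / N with hz
  have hz0 : 0 < z := by positivity
  set x : ℝ := t / N with hx
  have hx0 : 0 < x := by positivity
  have hxz : x ≤ 2 * z := by
    rw [hx, hz, ← mul_div_assoc]
    gcongr
    exact_mod_cast hts
  have h1 : ((c * N).choose s : ℝ) ≤ (3 * c / z) ^ s := by
    refine (choose_le_three_mul_div_pow _ _ hs).trans (le_of_eq ?_)
    rw [hz]
    push_cast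
    field_simp
  have h2 : ((3 * N).choose t : ℝ) ≤ 81 ^ s / x ^ t := by
    refine (choose_le_three_mul_div_pow _ _ ht0).trans ?_
    have : (3 * ((3 * N : ℕ) : ℝ) / t) = 9 / x := by
      rw [hx]
      push_cast
      field_simp
      norm_num
    rw [this, div_pow]
    gcongr
    calc (9 : ℝ) ^ t ≤ 9 ^ (2 * s) := by gcongr; norm_num
      _ = 81 ^ s := by rw [pow_mul]; norm_num
  have h3 : x ^ (3 * s) ≤ x ^ t * ((2 * z) ^ s * w ^ s) := by
    have hsplit : 3 * s = t + (s + (2 * s - t)) := by omega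
    rw [hsplit, pow_add, pow_add]
    have h4 : x ^ (2 * s - t) ≤ w ^ s := by
      calc x ^ (2 * s - t) ≤ (w ^ 4) ^ (2 * s - t) := by
            gcongr
            linarith
        _ = w ^ (4 * (2 * s - t)) := by rw [← pow_mul]
        _ ≤ w ^ s := pow_le_pow_of_le_one hw.le hw1 (by omega)
    gcongr
  calc _ ≤ (3 * c / z) ^ s * (81 ^ s / x ^ t) * (x ^ t * ((2 * z) ^ s * w ^ s)) := by gcongr
    _ = ((3 * c / z) * 81 * (2 * z) * w) ^ s := by
        rw [mul_pow _ w, mul_pow _ (2 * z), mul_pow _ (81 : ℝ)]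
        have := (pow_pos hx0 t).ne'
        generalize (3 * c / z) ^ s = a
        generalize (2 * z) ^ s = b
        field_simp
    _ = _ := by
        congr 1
        field_simp
        ring

/-- Expanding parity systems of linear size exist. -/
theorem exists_expands (c : ℕ) (hc : 0 < c) : ∃ α : ℝ, 0 < α ∧ ∀ N R : ℕ, 0 < N →
    (R : ℝ) ≤ α * N →
      ∃ p : Fin (c * N) → Fin 3 → Fin N, Expands (parityMatrix p) R := by
  have hc' : (1 : ℝ) ≤ c := by exact_mod_cast hc
  -- Chosen to make the ratio `486 * c * w` equal to `1 / 3`, so that the union bound sums to less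
  -- than `1 / 2`.
  set w : ℝ := 1 / (1458 * c) with hw
  have hw0 : 0 < w := by positivity
  have hw1 : w ≤ 1 := by
    rw [hw, div_le_one (by positivity)]
    linarith
  have hcw : 486 * c * w = 1 / 3 := by
    rw [hw]
    field_simp
    norm_num
  refine ⟨w ^ 4 / 2, by positivity, fun N R hN hR => ?_⟩
  have hN' : (0 : ℝ) < N := by exact_mod_cast hN
  have : Nonempty (Fin N) := ⟨⟨0, hN⟩⟩
  have hgeom (R : ℕ) : ∑ s ∈ Finset.Icc 1 R, (1 / 3 : ℝ) ^ s = 1 / 2 - 1 / 2 * (1 / 3) ^ R := by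
    induction R with
    | zero => simp
    | succ R ih =>
      rw [Finset.sum_Icc_succ_top (by omega), ih, pow_succ]
      ring
  have hRN : 2 * R ≤ Fintype.card (Fin N) := by
    rw [Fintype.card_fin]
    have hw4 : w ^ 4 ≤ 1 := pow_le_one₀ hw0.le hw1
    have : (2 : ℝ) * R ≤ N := by nlinarith
    exact_mod_cast this
  obtain ⟨p, hp⟩ := exists_card_biUnion_ge (E := Fin (c * N)) hRN <| by
    rw [Fintype.card_fin, Fintype.card_fin]
    refine (Finset.sum_le_sum fun s hs => union_bound_term_le hN (Finset.mem_Icc.1 hs).1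
      hw0 hw1 ?_).trans_lt ?_
    · rw [div_le_iff₀ hN']
      refine le_trans ?_ hR
      exact_mod_cast (Finset.mem_Icc.1 hs).2
    · rw [hcw, hgeom]
      have : (0 : ℝ) < (1 / 3) ^ R := by positivity
      linarith
  exact ⟨p, expands_of_card_biUnion p hp⟩

end ThreeSAT

/-! ### Choice of parameters and conclusion -/

namespace ThreeSAT

/-- For every `k = o(n)` there is an inapproximable instance which, for both encodings, is
`C^k`-equivalent to a satisfiable one. -/
theorem exists_parityInstance {ε : ℝ} (hε : 0 < ε) {k : ℕ → ℕ}
    (hk : (fun n : ℕ => (k n : ℝ)) =o[atTop] (fun n : ℕ => (n : ℝ))) :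
    ∃ (c N r : ℕ) (p : Fin (c * N) → Fin 3 → Fin N) (b : Fin (c * N) → Bool), 0 < N ∧
      6 * k ((6 + 32 * c) * N) ≤ r ∧ 1 ≤ r ∧
      ParitySystem.Expands (parityMatrix p) (2 * r) ∧
      ¬ (parityInstance p b).CSatisfiable (7 / 8 + ε) := by
  obtain ⟨c, hc⟩ := exists_nat_gt (6 / (32 * ε ^ 2))
  have hc0 : 0 < c := by
    have : (0 : ℝ) < c := lt_trans (by positivity) hc
    exact_mod_cast this
  rw [div_lt_iff₀ (by positivity)] at hc
  obtain ⟨α, hα, hexp⟩ := exists_expands c hc0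
  have hD : (0 : ℝ) < 6 + 32 * c := by positivity
  -- The first encoding has `(6 + 32 * c) * N` elements. With `r = 6 * k + 1`, expansion is needed
  -- up to `2 * r = 12 * k + 2`: here `12 * k ≤ α * N / 2`, and `N ≥ 4 / α` covers the `2`.
  have hev := hk.bound (show 0 < α / (24 * (6 + 32 * c)) by positivity)
  have hmul : Tendsto (fun N : ℕ => (6 + 32 * c) * N) atTop atTop :=
    tendsto_id.const_mul_atTop' (by omega)
  obtain ⟨N, hN, hNα, hN0⟩ := ((hmul.eventually hev).and
    ((tendsto_natCast_atTop_atTop.eventually_ge_atTop (4 / α)).and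
      (eventually_gt_atTop 0))).exists
  rw [div_le_iff₀ hα] at hNα
  have hkN : 24 * (k ((6 + 32 * c) * N) : ℝ) ≤ α * N := by
    rw [Real.norm_natCast, Real.norm_natCast] at hN
    push_cast at hN
    calc 24 * (k ((6 + 32 * c) * N) : ℝ)
        ≤ 24 * (α / (24 * (6 + 32 * c)) * ((6 + 32 * c) * N)) := by gcongr
      _ = α * N := by field_simp
  obtain ⟨p, hp⟩ := hexp N (2 * (6 * k ((6 + 32 * c) * N) + 1)) hN0 (by
    push_cast
    linarith)
  obtain ⟨b, hb⟩ := exists_not_cSatisfiable p hε (by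
    have : (0 : ℝ) < N := by exact_mod_cast hN0
    rw [Fintype.card_fin, Fintype.card_fin]
    push_cast
    nlinarith)
  exact ⟨c, N, _, p, b, hN0, Nat.le_succ _, by omega, hp, hb⟩

theorem card_finStr₁_parityInstance {E W : Type} [Fintype E] [Fintype W] [Nonempty W]
    (p : E → Fin 3 → W) (b : E → Bool) :
    Nat.card (finStr₁ (parityInstance p b)).carrier =
      6 * Fintype.card W + 32 * Fintype.card E := by
  change Nat.card (((Fin 3 × W) × Bool) ⊕ (E × (Fin 3 → Bool) × Bool × Bool)) = _
  simp
  ring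

theorem card_finStr₂_parityInstance {E W : Type} [Fintype E] [Fintype W] [Nonempty W]
    (p : E → Fin 3 → W) (b : E → Bool) :
    Nat.card (finStr₂ (parityInstance p b)).carrier = 6 * Fintype.card W := by
  change Nat.card ((Fin 3 × W) × Bool) = _
  simp
  ring

end ThreeSAT

theorem mainTheorem2 (ε : ℝ) (hε : 0 < ε) (k : ℕ → ℕ)
    (hk : (fun n : ℕ => (k n : ℝ)) =o[atTop] (fun n : ℕ => (n : ℝ))) :
    (¬ CountingLogic.CkSeparable
        (ThreeSAT.class₁ fun I => I.Satisfiable)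
        (ThreeSAT.class₁ fun I => ¬ I.CSatisfiable (7 / 8 + ε)) k) ∧
    (¬ CountingLogic.CkSeparable
        (ThreeSAT.class₂ fun I => I.Satisfiable)
        (ThreeSAT.class₂ fun I => ¬ I.CSatisfiable (7 / 8 + ε)) k) := by
  obtain ⟨c, N, r, p, b, hN, hkr, hr, hp, hb⟩ := ThreeSAT.exists_parityInstance hε hk
  have : Nonempty (Fin N) := ⟨⟨0, hN⟩⟩
  have hinj := ThreeSAT.injective_of_expands hp (by omega)
  have hsat := ThreeSAT.parityInstance_zero_satisfiable p
  constructor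
  · have hcard (b) : Nat.card (ThreeSAT.finStr₁ (ThreeSAT.parityInstance p b)).carrier ≤
        (6 + 32 * c) * N := by
      rw [ThreeSAT.card_finStr₁_parityInstance, Fintype.card_fin, Fintype.card_fin]
      exact le_of_eq (by ring)
    exact fun h => h _ (ThreeSAT.finStr₁ (ThreeSAT.parityInstance p 0))
      ⟨_, hsat, ⟨FirstOrder.Language.Equiv.refl _ _⟩⟩
      (ThreeSAT.finStr₁ (ThreeSAT.parityInstance p b))
      ⟨_, hb, ⟨FirstOrder.Language.Equiv.refl _ _⟩⟩ (hcard 0) (hcard b)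
      (ThreeSAT.ckEquiv_finStr₁ p 0 b hp hkr)
  · have hcard (b) : Nat.card (ThreeSAT.finStr₂ (ThreeSAT.parityInstance p b)).carrier ≤
        (6 + 32 * c) * N := by
      rw [ThreeSAT.card_finStr₂_parityInstance, Fintype.card_fin]
      exact Nat.mul_le_mul_right N (by omega)
    exact fun h => h _ (ThreeSAT.finStr₂ (ThreeSAT.parityInstance p 0))
      ⟨_, ThreeSAT.parityInstance_isSimple p 0 hinj, hsat,
        ⟨FirstOrder.Language.Equiv.refl _ _⟩⟩
      (ThreeSAT.finStr₂ (ThreeSAT.parityInstance p b))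
      ⟨_, ThreeSAT.parityInstance_isSimple p b hinj, hb,
        ⟨FirstOrder.Language.Equiv.refl _ _⟩⟩ (hcard 0) (hcard b)
      (ThreeSAT.ckEquiv_finStr₂ p 0 b hp hkr)
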